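/- Let $a_\ell<a_u$ be real numbers and let $0<\delta<1$. There is a constant $C>0$, depending only on $a_\ell,a_u,\delta$, such that the following holds. Let $n,p,\tilde K\ge 1$ be integers with $p\ge\max(260,\tfrac{33\tilde K}{2}+1)$, let $0<q\le1$, $R_q>0$, $T>0$, and let $D=[d_1,\dots,d_p]\in\mathbb R^{p\times p}$ be an orthogonal matrix with $d_1=p^{-1/2}\mathbf 1$; put $\bar D=[d_2,\dots,d_p]$. Let $\tilde A\in[a_\ell/\sqrt n,a_u/\sqrt n]^{n\times p}$ and $$A=\frac{\tilde A+\frac{a_u-2a_\ell}{\sqrt n}\mathbf 1_{n\times p}}{2(a_u-a_\ell)\sqrt n},$$ and suppose that $\|\tilde A Du\|_2^2\le(1+\delta)\|u\|_2^2$ for all $u\in\mathbb R^p$ with at most $2\tilde K$ nonzero coordinates. Suppose also that $\tilde K\le c_0R_q\left(\frac{\log p}{T}\right)^{-q/2}$ for a constant $c_0>0$. Define $$\mathcal F_{p,q,D}=\{f\in\mathbb R^p:\ f\ge0,\ \|f\|_1=1,\ \textstyle\sum_{j=1}^{p-1}|(\bar D^\top f)_j|^q\le R_q\},\qquad \lambda_k=\max_{v\in\{-1,0,1\}^{p-1},\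 \|v\|_0=k}\|\bar Dv\|_\infty ,$$ and for $f^*\in\mathcal F_{p,q,D}$ let $\mathbb P_{f^*}$ be the law of $y=(y_1,\dots,y_n)$ with independent $y_i\sim\mathrm{Poisson}(T(Af^*)_i)$. Then, with $C_L=C\min(1,c_0^{-2/q})$, $$\inf_{\hat f}\ \sup_{f^*\in\mathcal F_{p,q,D}}\ \mathbb P_{f^*}\!\left(\|\hat f(y)-f^*\|_2^2\ \ge\ C_L\max_{1\le k\le\tilde K}\min\!\left(\frac{k}{p^2\lambda_k^2},\ \frac{k\log(p/k)}{T}\right)\right)>\frac12 ,$$ where the infimum is over all measurable functions $\hat f:\mathbb{Z}_{\ge 0}^n\to\mathbb R^p$ (which may depend on all the fixed quantities, in particular on $A$). Moreover, for $k=\tilde K$ the second term scales as $R_q\left(\frac{\log p}{T}\right)^{1-q/2}$: one has $$\frac{\tilde K\log(p/\tilde K)}{T}\le c_0R_q\left(\frac{\log p}{T}\right)^{1-q/2},$$ and if, for some $c_1,\varepsilon>0$, $\tilde K\ge c_1R_q\left(\frac{\log p}{T}\right)^{-q/2}$ and $\tilde K\le p^{1-\varepsilon}$, then $$\frac{\tilde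 K\log(p/\tilde K)}{T}\ge \varepsilon c_1R_q\left(\frac{\log p}{T}\right)^{1-q/2}.$$ -/

import Mathlib

open MeasureTheory ProbabilityTheory
open scoped Matrix ENNReal

noncomputable section

namespace PoissonInverse

/-- The Euclidean norm of a real vector. -/
def l2norm {ι : Type*} [Fintype ι] (v : ι → ℝ) : ℝ := ‖WithLp.toLp 2 v‖

/-- The index set of the last `p - 1` columns of a `p × p` matrix. -/
abbrev Tail (p : ℕ) [NeZero p] : Type := {j : Fin p // j ≠ 0}

/-- `D` is an orthonormal basis matrix whose first column is the constant vector `p^{-1/2} 1`. -/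
def IsBasis {p : ℕ} [NeZero p] (D : Matrix (Fin p) (Fin p) ℝ) : Prop :=
  D ∈ Matrix.orthogonalGroup (Fin p) ℝ ∧ ∀ i, D i 0 = 1 / √(p : ℝ)

/-- `D̄ = [d₂, …, d_p]`, the matrix `D` with its first column removed. -/
def dropFirst {p : ℕ} [NeZero p] (D : Matrix (Fin p) (Fin p) ℝ) : Matrix (Fin p) (Tail p) ℝ :=
  D.submatrix id Subtype.val

/-- The class `F_{p,q,D}` with radius `R`: nonnegative vectors `f` with `‖f‖₁ = 1` and
`‖D̄ᵀ f‖_q^q ≤ R`. -/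
def signalClass {p : ℕ} [NeZero p] (q R : ℝ) (D : Matrix (Fin p) (Fin p) ℝ) :
    Set (Fin p → ℝ) :=
  {f | (∀ i, 0 ≤ f i) ∧ ∑ i, |f i| = 1 ∧ ∑ j, |((dropFirst D)ᵀ *ᵥ f) j| ^ q ≤ R}

/-- The sensing matrix obtained from `B` (the matrix `Ã`) by shifting and rescaling:
`A = (Ã + ((a_u - 2 a_ℓ)/√n) 1) / (2 (a_u - a_ℓ) √n)`. -/
def sensingMatrix {n p : ℕ} (al au : ℝ) (B : Matrix (Fin n) (Fin p) ℝ) :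
    Matrix (Fin n) (Fin p) ℝ :=
  Matrix.of fun i j => (B i j + (au - 2 * al) / √(n : ℝ)) / (2 * (au - al) * √(n : ℝ))

/-- The upper restricted isometry property: `‖M u‖₂² ≤ (1 + δ) ‖u‖₂²` for all `u` with at most
`s` nonzero coordinates. -/
def UpperRIP {n p : ℕ} (M : Matrix (Fin n) (Fin p) ℝ) (s : ℕ) (δ : ℝ) : Prop :=
  ∀ u : Fin p → ℝ, hammingNorm u ≤ s → l2norm (M *ᵥ u) ^ 2 ≤ (1 + δ) * l2norm u ^ 2

/-- The `k`-sparse localization quantity `λ_k(X)`: the maximum of `‖X v‖_∞` over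
`v ∈ {-1, 0, 1}^κ` with exactly `k` nonzero coordinates (the norm of `ι → ℝ` is the sup norm). -/
def sparseLoc {ι κ : Type*} [Fintype ι] [Fintype κ] (k : ℕ) (X : Matrix ι κ ℝ) : ℝ :=
  sSup {r | ∃ v : κ → ℝ, (∀ j, v j = -1 ∨ v j = 0 ∨ v j = 1) ∧ hammingNorm v = k ∧
    r = ‖X *ᵥ v‖}

/-- The law of `y ∼ Poisson(T A f)`: independent coordinates `y_i ∼ Poisson(T (A f)_i)`. The
truncation at `0` is harmless, the means being nonnegative for `T ≥ 0`, `A ≥ 0`, `f ≥ 0`. -/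
def poissonLaw {n p : ℕ} (T : ℝ) (A : Matrix (Fin n) (Fin p) ℝ) (f : Fin p → ℝ) :
    Measure (Fin n → ℕ) :=
  Measure.pi fun i => poissonMeasure (T * (A *ᵥ f) i).toNNReal

/-- The minimax probability that the squared `ℓ₂` error is at least `r`: the infimum over all
measurable estimators (functions of the data `y`, the matrix `A` being known and fixed) of the
supremum over `f ∈ F` of `P_f (‖fhat(y) - f‖₂² ≥ r)`. -/
def minimaxProb {n p : ℕ} (T : ℝ) (A : Matrix (Fin n) (Fin p) ℝ) (F : Set (Fin p → ℝ))
    (r : ℝ) : ℝ≥0∞ :=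
  ⨅ (fhat : (Fin n → ℕ) → (Fin p → ℝ)) (_ : Measurable fhat),
    ⨆ f ∈ F, poissonLaw T A f {y | r ≤ l2norm (fhat y - f) ^ 2}

/-- `max_{1 ≤ k ≤ K} min (k / (p² λ_k(D̄)²), k log(p/k) / T)`. -/
def lowerRate {p : ℕ} [NeZero p] (T : ℝ) (D : Matrix (Fin p) (Fin p) ℝ) (K : ℕ) (hK : 1 ≤ K) :
    ℝ :=
  (Finset.Icc 1 K).sup' (Finset.nonempty_Icc.mpr hK) fun k =>
    min ((k : ℝ) / ((p : ℝ) ^ 2 * sparseLoc k (dropFirst D) ^ 2))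
      ((k : ℝ) * Real.log ((p : ℝ) / k) / T)

end PoissonInverse

end

open scoped NNReal

/-! The argument is a direct chi-square testing bound, with no Fano inequality and no extraction of
a packing. The hypotheses are `f₀ + η D̄ v_w`, with `f₀ = 1/p` uniform and `v_w` the 0/1 vector
marking one column in each of `k` disjoint blocks of size `s = ⌊(p-1)/k⌋`. All `s^k` words `w` are
used.

Since `D̄` is an isometry, an estimate within squared error `r ≤ η²k/4` of two hypotheses forces
their words to differ in fewer than `k/2` letters. A given sample is therefore accepted by at most
`(2√s)^k` words (`card_hammingDist_lt_le`). The shift in `A` keeps the Poisson means at `f₀` above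
`T/(2n)`, so the restricted isometry bounds the chi-square exponent by a multiple of `Tη²k`
(`sum_sq_div_le`). Change of measure to `f₀`, averaged over words, then yields a word with
acceptance probability at most `9/20` (`exists_pi_poissonMeasure_real_le`, `five_mul_exp_mul_le`).

The amplitude `η` is limited by nonnegativity (through `λ_k`), the `ℓ_q` radius, and the chi-square
budget. At the maximizing `k`, `η²k` still has the order of the rate. -/

namespace PoissonInverse

/-! ### Change of measure for Poisson products -/

/-- On a countable space, a comparison of measures on singletons extends to all sets. -/
theorem measureReal_le_of_singleton {Ω : Type*} [MeasurableSpace Ω] [Countable Ω]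
    [MeasurableSingletonClass Ω] (μ ν ρ : Measure Ω) [IsFiniteMeasure μ] [IsFiniteMeasure ν]
    [IsFiniteMeasure ρ] {α β : ℝ} (hα : 0 ≤ α) (hβ : 0 ≤ β)
    (h : ∀ y, μ.real {y} ≤ α * ν.real {y} + β * ρ.real {y}) (E : Set Ω) :
    μ.real E ≤ α * ν.real E + β * ρ.real E := by
  have hE : MeasurableSet E := E.to_countable.measurableSet
  have key : μ E ≤ (ENNReal.ofReal α • ν + ENNReal.ofReal β • ρ) E := by
    rw [← Measure.tsum_indicator_apply_singleton μ E hE,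
      ← Measure.tsum_indicator_apply_singleton _ E hE]
    refine ENNReal.tsum_le_tsum fun y => Set.indicator_le_indicator ?_
    rw [Measure.add_apply, Measure.smul_apply, Measure.smul_apply, smul_eq_mul, smul_eq_mul,
      ← ofReal_measureReal (μ := μ), ← ofReal_measureReal (μ := ν), ← ofReal_measureReal (μ := ρ),
      ← ENNReal.ofReal_mul hα, ← ENNReal.ofReal_mul hβ, ← ENNReal.ofReal_add (by positivity)
      (by positivity)]
    exact ENNReal.ofReal_le_ofReal (h y)
  rw [Measure.add_apply, Measure.smul_apply, Measure.smul_apply, smul_eq_mul, smul_eq_mul,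
      ← ofReal_measureReal (μ := μ), ← ofReal_measureReal (μ := ν), ← ofReal_measureReal (μ := ρ),
      ← ENNReal.ofReal_mul hα, ← ENNReal.ofReal_mul hβ, ← ENNReal.ofReal_add (by positivity)
      (by positivity)] at key
  exact (ENNReal.ofReal_le_ofReal_iff (by positivity)).1 key

/-- The square of the mass function of `Poisson(a)` divided by that of `Poisson(b)` is a multiple
of the mass function of `Poisson(a² / b)`. -/
theorem poissonMeasure_real_singleton_sq (a b : ℝ≥0) (hb : 0 < b) (m : ℕ) :
    (poissonMeasure a).real {m} ^ 2 = Real.exp (((a : ℝ) - b) ^ 2 / b) *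
      (poissonMeasure (a ^ 2 / b)).real {m} * (poissonMeasure b).real {m} := by
  have hb' : (b : ℝ) ≠ 0 := by positivity
  simp only [poissonMeasure_real_singleton]
  push_cast
  -- Completing the square: `-2a = (a-b)²/b - a²/b - b`.
  have h1 : Real.exp (-(a : ℝ)) ^ 2 =
      Real.exp (((a : ℝ) - b) ^ 2 / b) * Real.exp (-((a : ℝ) ^ 2 / b)) * Real.exp (-(b : ℝ)) := by
    rw [← Real.exp_add, ← Real.exp_add, ← Real.exp_nat_mul]
    congr 1
    field_simp
    push_cast
    ring
  have h2 : ((a : ℝ) ^ m) ^ 2 = ((a : ℝ) ^ 2 / b) ^ m * (b : ℝ) ^ m := by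
    rw [← mul_pow, div_mul_cancel₀ _ hb', ← pow_mul, ← pow_mul, mul_comm]
  rw [div_pow, mul_pow, h1, h2]
  ring

theorem pi_poissonMeasure_real_singleton_sq {ι : Type*} [Fintype ι] (a b : ι → ℝ≥0)
    (hb : ∀ i, 0 < b i) (y : ι → ℕ) :
    (Measure.pi fun i => poissonMeasure (a i)).real {y} ^ 2 =
      Real.exp (∑ i, ((a i : ℝ) - b i) ^ 2 / b i) *
      (Measure.pi fun i => poissonMeasure (a i ^ 2 / b i)).real {y} *
      (Measure.pi fun i => poissonMeasure (b i)).real {y} := by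
  have h : ∀ c : ι → ℝ≥0, (Measure.pi fun i => poissonMeasure (c i)).real {y} =
      ∏ i, (poissonMeasure (c i)).real {y i} := fun c => by
    simp [measureReal_def, Measure.pi_singleton, ENNReal.toReal_prod]
  rw [h, h, h, Real.exp_sum, ← Finset.prod_pow, ← Finset.prod_mul_distrib,
    ← Finset.prod_mul_distrib]
  exact Finset.prod_congr rfl fun i _ => poissonMeasure_real_singleton_sq _ _ (hb i) _

/-- Change of measure for products of Poisson laws, through the chi-square divergence. -/
theorem pi_poissonMeasure_real_le {ι : Type*} [Fintype ι] (a b : ι → ℝ≥0)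
    (hb : ∀ i, 0 < b i) {X : ℝ} (hX : Real.exp (∑ i, ((a i : ℝ) - b i) ^ 2 / b i) ≤ X)
    {t : ℝ} (ht : 0 < t) (E : Set (ι → ℕ)) :
    (Measure.pi fun i => poissonMeasure (a i)).real E ≤
      t / 2 * X + (2 * t)⁻¹ * (Measure.pi fun i => poissonMeasure (b i)).real E := by
  have hX0 : 0 < X := (Real.exp_pos _).trans_le hX
  have := measureReal_le_of_singleton (Measure.pi fun i => poissonMeasure (a i))
    (Measure.pi fun i => poissonMeasure (a i ^ 2 / b i))
    (Measure.pi fun i => poissonMeasure (b i)) (α := t / 2 * X) (β := (2 * t)⁻¹)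
    (by positivity) (by positivity) (fun y => ?_) E
  · refine this.trans (add_le_add_left (mul_le_of_le_one_right (by positivity) ?_) _)
    exact measureReal_le_one
  · have h := pi_poissonMeasure_real_singleton_sq a b hb y
    set A := (Measure.pi fun i => poissonMeasure (a i)).real {y}
    set B := (Measure.pi fun i => poissonMeasure (b i)).real {y} with hB
    set G := (Measure.pi fun i => poissonMeasure (a i ^ 2 / b i)).real {y} with hG
    have hB0 : 0 ≤ B := measureReal_nonneg
    have hG0 : 0 ≤ G := measureReal_nonneg
    have h1 : A ^ 2 ≤ X * G * B := by
      rw [h]; gcongr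
    -- AM-GM, `(x+y)² ≥ 4xy`; the weights make `4xy` equal to `X * G * B` for every `t`.
    have h2 : A ^ 2 ≤ (t / 2 * X * G + (2 * t)⁻¹ * B) ^ 2 := by
      have e : (t / 2 * X * G) * ((2 * t)⁻¹ * B) * 4 = X * G * B := by
        field_simp; ring
      nlinarith [sq_nonneg (t / 2 * X * G - (2 * t)⁻¹ * B)]
    exact le_of_sq_le_sq h2 (by positivity)

/-- If every point lies in at most `N` of the sets `E i`, their probabilities add up to at most
`N`. -/
theorem sum_measureReal_le {Ω ι : Type*} [MeasurableSpace Ω] [Fintype ι] (Q : Measure Ω)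
    [IsProbabilityMeasure Q] (E : ι → Set Ω) (hE : ∀ i, MeasurableSet (E i)) {N : ℝ}
    (hN : ∀ y, ∑ i, (E i).indicator (1 : Ω → ℝ) y ≤ N) : ∑ i, Q.real (E i) ≤ N := by
  have hi : ∀ i, Integrable ((E i).indicator (1 : Ω → ℝ)) Q := fun i =>
    (integrable_const (1 : ℝ)).indicator (hE i)
  calc ∑ i, Q.real (E i) = ∑ i, ∫ y, (E i).indicator (1 : Ω → ℝ) y ∂Q := by
        simp only [integral_indicator_one (hE _)]
    _ = ∫ y, ∑ i, (E i).indicator (1 : Ω → ℝ) y ∂Q :=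
        (integral_finsetSum _ fun i _ => hi i).symm
    _ ≤ ∫ _, N ∂Q := integral_mono (integrable_finsetSum _ fun i _ => hi i)
        (integrable_const _) hN
    _ = N := by simp

/-- Testing lower bound: among Poisson models that are all close to a common one, some model gives
small probability to its acceptance region. -/
theorem exists_pi_poissonMeasure_real_le {ι κ : Type*} [Fintype ι] [Fintype κ] [Nonempty κ]
    (a : κ → ι → ℝ≥0) (b : ι → ℝ≥0) (hb : ∀ i, 0 < b i) {X N : ℝ}
    (hX : ∀ w, Real.exp (∑ i, ((a w i : ℝ) - b i) ^ 2 / b i) ≤ X)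
    (hXN : 5 * (X * N) ≤ Fintype.card κ) (E : κ → Set (ι → ℕ))
    (hN : ∀ y, ∑ w, (E w).indicator (1 : (ι → ℕ) → ℝ) y ≤ N) :
    ∃ w, (Measure.pi fun i => poissonMeasure (a w i)).real (E w) ≤ 9 / 20 := by
  by_contra! hc
  have hX0 : 0 < X := (Real.exp_pos _).trans_le (hX (Classical.arbitrary κ))
  have h1 : ∀ w, (9 / 20 : ℝ) < 1 / 4 +
      X * (Measure.pi fun i => poissonMeasure (b i)).real (E w) := fun w => by
    -- This `t` makes the additive error `1/4`. Averaging over words adds at most `X * N / card ≤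
    -- 1/5`, for a total of `9/20`.
    refine (hc w).trans_le ((pi_poissonMeasure_real_le (a w) b hb (hX w)
      (t := 1 / (2 * X)) (by positivity) (E w)).trans_eq ?_)
    field_simp
    ring
  have h2 := Finset.sum_lt_sum_of_nonempty (Finset.univ_nonempty (α := κ)) fun w _ => h1 w
  rw [Finset.sum_add_distrib, ← Finset.mul_sum] at h2
  have h3 := sum_measureReal_le (Measure.pi fun i => poissonMeasure (b i)) E
    (fun w => (E w).to_countable.measurableSet) hN
  have h4 := mul_le_mul_of_nonneg_left h3 hX0.le
  simp only [Finset.sum_const, Finset.card_univ, nsmul_eq_mul] at h2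
  linarith

/-! ### Volume of a Hamming ball -/

/-- The number of words of length `k` over an alphabet of size `s` at relative Hamming distance
less than one half from a given word. -/
theorem card_hammingDist_lt_le (k s : ℕ) (w₀ : Fin k → Fin s) :
    ((Finset.univ.filter fun w : Fin k → Fin s => 2 * hammingDist w w₀ < k).card : ℝ) ≤
      (2 * √(s : ℝ)) ^ k := by
  rcases Nat.eq_zero_or_pos k with rfl | hk
  · simp
  have hs : 1 ≤ s := Nat.one_le_iff_ne_zero.2 fun h => by subst h; exact (w₀ ⟨0, hk⟩).elim0
  have hs' : (1 : ℝ) ≤ s := by exact_mod_cast hs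
  have hq : (1 : ℝ) ≤ √s := Real.one_le_sqrt.2 hs'
  -- A Chernoff-type count: each agreement with `w₀` has weight `s`, so the total weight factors
  -- over letters, while every word of the ball has weight at least `√s ^ k`.
  have hsum : ∑ w : Fin k → Fin s, ∏ i, (if w i = w₀ i then (s : ℝ) else 1) ≤ (2 * s) ^ k := by
    have := Finset.prod_univ_sum (fun _ : Fin k => (Finset.univ : Finset (Fin s)))
      (fun i x => if x = w₀ i then (s : ℝ) else 1)
    rw [Fintype.piFinset_univ] at this
    rw [← this]
    calc _ ≤ ∏ _i : Fin k, (2 * s : ℝ) := by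
          refine Finset.prod_le_prod (fun i _ => Finset.sum_nonneg fun x _ => by positivity)
            fun i _ => ?_
          calc _ ≤ ∑ x : Fin s, ((if x = w₀ i then (s : ℝ) else 0) + 1) := by
                refine Finset.sum_le_sum fun x _ => ?_
                split_ifs <;> linarith
            _ = 2 * s := by simp [Finset.sum_add_distrib]; ring
      _ = _ := by simp
  have hterm : ∀ w : Fin k → Fin s, 2 * hammingDist w w₀ < k →
      √(s : ℝ) ^ k ≤ ∏ i, (if w i = w₀ i then (s : ℝ) else 1) := fun w hw => by
    rw [Finset.prod_ite, Finset.prod_const, Finset.prod_const_one, mul_one]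
    have hc : (Finset.univ.filter fun i => w i = w₀ i).card + hammingDist w w₀ = k := by
      unfold hammingDist
      rw [Finset.card_filter_add_card_filter_not]
      simp
    calc √(s : ℝ) ^ k ≤ √(s : ℝ) ^ (2 * (Finset.univ.filter fun i => w i = w₀ i).card) :=
          pow_le_pow_right₀ hq (by omega)
      _ = _ := by rw [pow_mul, Real.sq_sqrt (by positivity)]
  have hmul : ((Finset.univ.filter fun w : Fin k → Fin s => 2 * hammingDist w w₀ < k).card : ℝ) *
      √(s : ℝ) ^ k ≤ (2 * √(s : ℝ)) ^ k * √(s : ℝ) ^ k := by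
    rw [← mul_pow, mul_assoc, Real.mul_self_sqrt (by positivity)]
    refine le_trans ?_ hsum
    rw [← nsmul_eq_mul, ← Finset.sum_const]
    refine (Finset.sum_le_sum fun w hw => hterm w (Finset.mem_filter.1 hw).2).trans ?_
    exact Finset.sum_le_sum_of_subset_of_nonneg (Finset.filter_subset _ _) fun w _ _ =>
      Finset.prod_nonneg fun i _ => by positivity
  exact le_of_mul_le_mul_right hmul (by positivity)

/-! ### Euclidean norms and the basis -/

theorem l2norm_sq {ι : Type*} [Fintype ι] (v : ι → ℝ) : l2norm v ^ 2 = ∑ i, v i ^ 2 := by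
  simp [l2norm, EuclideanSpace.norm_sq_eq]

theorem l2norm_sub_sq_le {ι : Type*} [Fintype ι] (f g h : ι → ℝ) :
    l2norm (g - h) ^ 2 ≤ 2 * l2norm (f - g) ^ 2 + 2 * l2norm (f - h) ^ 2 := by
  simp only [l2norm_sq, Finset.mul_sum, ← Finset.sum_add_distrib, Pi.sub_apply]
  exact Finset.sum_le_sum fun i _ => by nlinarith [sq_nonneg (f i - g i + (f i - h i))]

section Basis

variable {p : ℕ} [NeZero p] {D : Matrix (Fin p) (Fin p) ℝ}

theorem IsBasis.transpose_mul_dropFirst (hD : IsBasis D) :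
    (dropFirst D)ᵀ * dropFirst D = 1 := by
  have h : Dᵀ * D = 1 := (Matrix.mem_orthogonalGroup_iff' _ _).1 hD.1
  ext i j
  have := congrFun (congrFun h i.1) j.1
  simp only [Matrix.mul_apply, dropFirst, Matrix.transpose_apply, Matrix.submatrix_apply,
    id_eq] at this ⊢
  rw [this, Matrix.one_apply, Matrix.one_apply]
  simp only [Subtype.ext_iff]

theorem IsBasis.sum_dropFirst (hD : IsBasis D) (j : Tail p) : ∑ i, dropFirst D i j = 0 := by
  have h : Dᵀ * D = 1 := (Matrix.mem_orthogonalGroup_iff' _ _).1 hD.1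
  have := congrFun (congrFun h 0) j.1
  rw [Matrix.one_apply_ne (Ne.symm j.2)] at this
  simp only [Matrix.mul_apply, Matrix.transpose_apply, hD.2, ← Finset.mul_sum] at this
  have hp : (0 : ℝ) < p := by exact_mod_cast Nat.pos_of_ne_zero (NeZero.ne p)
  exact (mul_eq_zero.1 this).resolve_left (by positivity)

theorem IsBasis.sum_dropFirst_mulVec (hD : IsBasis D) (v : Tail p → ℝ) :
    ∑ i, (dropFirst D *ᵥ v) i = 0 := by
  simp only [Matrix.mulVec, dotProduct]
  rw [Finset.sum_comm]
  simp only [← Finset.sum_mul, hD.sum_dropFirst, zero_mul, Finset.sum_const_zero]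

theorem IsBasis.l2norm_dropFirst_mulVec_sq (hD : IsBasis D) (v : Tail p → ℝ) :
    l2norm (dropFirst D *ᵥ v) ^ 2 = ∑ j, v j ^ 2 := by
  have h : (dropFirst D *ᵥ v) ⬝ᵥ (dropFirst D *ᵥ v) = v ⬝ᵥ v := by
    rw [Matrix.dotProduct_mulVec, ← Matrix.mulVec_transpose, Matrix.mulVec_mulVec,
      hD.transpose_mul_dropFirst, Matrix.one_mulVec]
  rw [l2norm_sq]
  simpa only [dotProduct, sq] using h

/-- Extension by zero to the first coordinate. -/
def extendZero (v : Tail p → ℝ) : Fin p → ℝ := fun j => if h : j ≠ 0 then v ⟨j, h⟩ else 0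

theorem sum_eq_zero_add_sum_tail (g : Fin p → ℝ) : ∑ j, g j = g 0 + ∑ j : Tail p, g j.1 := by
  rw [Fintype.sum_eq_add_sum_subtype_ne g 0]

theorem mulVec_extendZero (v : Tail p → ℝ) : D *ᵥ extendZero v = dropFirst D *ᵥ v := by
  ext i
  simp only [Matrix.mulVec, dotProduct]
  rw [sum_eq_zero_add_sum_tail]
  have h0 : extendZero v 0 = 0 := by simp [extendZero]
  rw [h0, mul_zero, zero_add]
  refine Finset.sum_congr rfl fun j _ => ?_
  simp [extendZero, dropFirst, j.2]

theorem l2norm_extendZero_sq (v : Tail p → ℝ) : l2norm (extendZero v) ^ 2 = ∑ j, v j ^ 2 := by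
  rw [l2norm_sq, sum_eq_zero_add_sum_tail]
  have h0 : extendZero v 0 = 0 := by simp [extendZero]
  rw [h0, zero_pow two_ne_zero, zero_add]
  refine Finset.sum_congr rfl fun j _ => ?_
  simp [extendZero, j.2]

theorem hammingNorm_extendZero_le (v : Tail p → ℝ) :
    hammingNorm (extendZero v) ≤ hammingNorm v := by
  unfold hammingNorm
  refine (Finset.card_le_card fun j hj => ?_).trans
    (Finset.card_map (Function.Embedding.subtype fun j : Fin p => j ≠ 0)).le
  rw [Finset.mem_filter_univ] at hj
  have h0 : j ≠ 0 := fun h => hj (by simp [extendZero, h])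
  rw [Finset.mem_map]
  refine ⟨⟨j, h0⟩, ?_, rfl⟩
  rw [Finset.mem_filter_univ]
  simpa [extendZero, h0] using hj

/-- The restricted isometry property on the columns of `D̄`. -/
theorem UpperRIP.l2norm_mulVec_dropFirst_sq_le {n s : ℕ} {δ : ℝ} {B : Matrix (Fin n) (Fin p) ℝ}
    (h : UpperRIP (B * D) s δ) (v : Tail p → ℝ) (hv : hammingNorm v ≤ s) :
    l2norm (B *ᵥ (dropFirst D *ᵥ v)) ^ 2 ≤ (1 + δ) * ∑ j, v j ^ 2 := by
  have := h (extendZero v) ((hammingNorm_extendZero_le v).trans hv)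
  rwa [← Matrix.mulVec_mulVec, mulVec_extendZero, l2norm_extendZero_sq] at this

/-- Only finitely many sign vectors exist, so the real `sSup` is over a bounded set and is a genuine
upper bound. -/
theorem norm_mulVec_le_sparseLoc {ι κ : Type*} [Fintype ι] [Fintype κ] {k : ℕ}
    (X : Matrix ι κ ℝ) {v : κ → ℝ} (hv : ∀ j, v j = -1 ∨ v j = 0 ∨ v j = 1)
    (hk : hammingNorm v = k) : ‖X *ᵥ v‖ ≤ sparseLoc k X := by
  refine le_csSup (Set.Finite.bddAbove ?_) ⟨v, hv, hk, rfl⟩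
  have hf : ({v : κ → ℝ | ∀ j, v j ∈ ({-1, 0, 1} : Set ℝ)}).Finite :=
    Set.Finite.pi' fun _ => Set.toFinite _
  refine (hf.image fun v => ‖X *ᵥ v‖).subset ?_
  rintro r ⟨v, hv, -, rfl⟩
  exact ⟨v, fun j => by simpa using hv j, rfl⟩

end Basis

/-! ### Codewords as sparse 0/1 vectors -/

section Code

variable {κ : Type*} [DecidableEq κ] {k s : ℕ} (e : Fin k × Fin s ↪ κ)

/-- The zero-one vector that marks, in each of `k` blocks of size `s`, the letter of the word `w`
in that block. -/
def codeVec (w : Fin k → Fin s) : κ → ℝ := fun j =>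
  if j ∈ Finset.univ.image (fun i => e (i, w i)) then 1 else 0

theorem codeVec_apply (w : Fin k → Fin s) (i : Fin k) (x : Fin s) :
    codeVec e w (e (i, x)) = if w i = x then 1 else 0 := by
  simp [codeVec]

theorem codeVec_eq_zero_or_one (w : Fin k → Fin s) (j : κ) :
    codeVec e w j = 0 ∨ codeVec e w j = 1 := by
  unfold codeVec; split_ifs <;> simp

theorem codeVec_sq (w : Fin k → Fin s) (j : κ) : codeVec e w j ^ 2 = codeVec e w j := by
  rcases codeVec_eq_zero_or_one e w j with h | h <;> simp [h]

variable [Fintype κ]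

theorem sum_codeVec_mul (w : Fin k → Fin s) (g : κ → ℝ) :
    ∑ j, codeVec e w j * g j = ∑ i, g (e (i, w i)) := by
  simp only [codeVec, ite_mul, one_mul, zero_mul, Finset.sum_ite_mem, Finset.univ_inter]
  rw [Finset.sum_image]
  intro i _ j _ h
  simpa using congrArg Prod.fst (e.injective h)

theorem sum_codeVec (w : Fin k → Fin s) : ∑ j, codeVec e w j = k := by
  simpa using sum_codeVec_mul e w 1

theorem hammingNorm_codeVec (w : Fin k → Fin s) : hammingNorm (codeVec e w) = k := by
  have h : (hammingNorm (codeVec e w) : ℝ) = k := by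
    rw [← sum_codeVec e w, hammingNorm, Finset.card_filter, Nat.cast_sum]
    refine Finset.sum_congr rfl fun j _ => ?_
    rcases codeVec_eq_zero_or_one e w j with h | h <;> simp [h]
  exact_mod_cast h

/-- Each block where the words differ contributes two unmatched marks; the others cancel. -/
theorem sum_codeVec_sub_sq (w w' : Fin k → Fin s) :
    ∑ j, (codeVec e w j - codeVec e w' j) ^ 2 = 2 * hammingDist w w' := by
  have h1 : ∑ j, codeVec e w j * codeVec e w' j = k - hammingDist w w' := by
    rw [sum_codeVec_mul]
    simp only [codeVec_apply]
    rw [Finset.sum_boole, eq_sub_iff_add_eq]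
    unfold hammingDist
    rw [← Nat.cast_add]
    have : (Finset.univ.filter fun i => w' i = w i) = Finset.univ.filter fun i => w i = w' i :=
      Finset.filter_congr fun i _ => eq_comm
    rw [this, Finset.card_filter_add_card_filter_not]
    simp
  have h2 : ∀ j, (codeVec e w j - codeVec e w' j) ^ 2 =
      codeVec e w j + codeVec e w' j - 2 * (codeVec e w j * codeVec e w' j) := fun j => by
    rw [sub_sq, codeVec_sq, codeVec_sq]; ring
  simp only [h2, Finset.sum_sub_distrib, Finset.sum_add_distrib, ← Finset.mul_sum, sum_codeVec, h1]
  ring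

theorem sum_abs_mul_codeVec_rpow (w : Fin k → Fin s) {η q : ℝ} (hη : 0 ≤ η) (hq : 0 < q) :
    ∑ j, |η * codeVec e w j| ^ q = k * η ^ q := by
  rw [← sum_codeVec e w, Finset.sum_mul]
  refine Finset.sum_congr rfl fun j _ => ?_
  rcases codeVec_eq_zero_or_one e w j with h | h <;> simp [h, hq.ne', abs_of_nonneg hη]

end Code

/-! ### Counting words against the chi-square factor -/

/-- The number of words of length `k` over an alphabet of size `⌊(p - 1) / k⌋` is large compared
with the number of words in a Hamming ball of radius `k / 2`. -/
theorem five_mul_exp_mul_le {p k : ℕ} (hk : 1 ≤ k) (hp : 260 ≤ p)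
    (hkp : 33 * (k : ℝ) / 2 + 1 ≤ p) {x : ℝ} (hx : x ≤ k * Real.log ((p : ℝ) / k) / 36) :
    5 * (Real.exp x * (2 * √(((p - 1) / k : ℕ) : ℝ)) ^ k) ≤ (((p - 1) / k : ℕ) : ℝ) ^ k := by
  have hkp' : 33 * k + 2 ≤ 2 * p := by
    have : 33 * (k : ℝ) + 2 ≤ 2 * p := by linarith
    exact_mod_cast this
  set s := (p - 1) / k with hs
  have hs16 : 16 ≤ s := (Nat.le_div_iff_mul_le hk).2 (by omega)
  have hs16' : (16 : ℝ) ≤ s := by exact_mod_cast hs16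
  have hps : p ≤ (s + 1) * k := by
    have := Nat.lt_div_mul_add (a := p - 1) (b := k) hk
    rw [← hs] at this
    rw [add_mul]; omega
  have hk0 : (0 : ℝ) < k := by exact_mod_cast hk
  -- `p/k ≤ s + 1`, and the cubic overtakes `s + 1` once `s ≥ 16`. The exponent 3 turns `1/36` into
  -- `1/12`, hence the twelfth power in `hX12`.
  have hpk : (p : ℝ) / k ≤ (s / 4) ^ 3 := by
    have h1 : (p : ℝ) / k ≤ s + 1 := by
      rw [div_le_iff₀ hk0]; exact_mod_cast hps
    nlinarith [mul_nonneg (mul_nonneg (sub_nonneg.2 hs16') (sub_nonneg.2 hs16'))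
      (sub_nonneg.2 hs16')]
  have hlog : Real.log ((p : ℝ) / k) ≤ 3 * Real.log (s / 4) := by
    have := Real.log_le_log (div_pos (by positivity) hk0) hpk
    rwa [Real.log_pow] at this
  have hX12 : Real.exp x ^ 12 ≤ ((s : ℝ) / 4) ^ k := by
    rw [← Real.exp_nat_mul, ← Real.exp_log (show (0 : ℝ) < s / 4 by positivity),
      ← Real.exp_nat_mul]
    refine Real.exp_le_exp.2 ?_
    have := mul_le_mul_of_nonneg_left hlog hk0.le
    push_cast
    linarith
  -- For `k ≥ 3`, `s ≥ 16` suffices; `k = 1, 2` need larger blocks, supplied by `p ≥ 260`.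
  have h64 : (64 : ℝ) ≤ ((s : ℝ) / 4) ^ k := by
    have h3 : k = 1 ∨ k = 2 ∨ 3 ≤ k := by omega
    rcases h3 with rfl | rfl | h3
    · have : 256 ≤ s := by omega
      have : (256 : ℝ) ≤ s := by exact_mod_cast this
      rw [pow_one]; linarith
    · have : 32 ≤ s := by omega
      have : (32 : ℝ) ≤ s := by exact_mod_cast this
      nlinarith
    · calc (64 : ℝ) = 4 ^ 3 := by norm_num
        _ ≤ 4 ^ k := pow_le_pow_right₀ (by norm_num) h3
        _ ≤ _ := pow_le_pow_left₀ (by norm_num) (by linarith) k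
  have hρ2 : ((√(s : ℝ) / 2) ^ k) ^ 2 = ((s : ℝ) / 4) ^ k := by
    rw [← pow_mul, mul_comm, pow_mul, div_pow, Real.sq_sqrt (by positivity)]
    norm_num
  have hM : (s : ℝ) ^ k = (√(s : ℝ) / 2) ^ k * (2 * √(s : ℝ)) ^ k := by
    rw [← mul_pow]
    congr 1
    have := Real.mul_self_sqrt (show (0 : ℝ) ≤ s by positivity)
    linarith
  have hX0 := Real.exp_pos x
  set X := Real.exp x
  set ρ := (√(s : ℝ) / 2) ^ k
  have hρ0 : 0 ≤ ρ := by positivity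
  have hρ8 : 8 ≤ ρ := by
    rw [← hρ2] at h64
    exact le_of_sq_le_sq (by linarith) hρ0
  have hX6 : X ^ 6 ≤ ρ := by
    refine le_of_sq_le_sq ?_ hρ0
    rw [hρ2, ← pow_mul]; exact hX12
  -- Otherwise `X > 8/5`, so `X ^ 5 > 5` and `X ^ 6 > 5 * X > ρ`.
  have h5 : 5 * X ≤ ρ := by
    by_contra! hlt
    have h1 : 8 / 5 < X := by linarith
    have h2 : (8 / 5 : ℝ) ^ 5 ≤ X ^ 5 := pow_le_pow_left₀ (by norm_num) h1.le 5
    nlinarith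
  rw [hM, ← mul_assoc]
  exact mul_le_mul_of_nonneg_right h5 (by positivity)

/-! ### Poisson means and their chi-square exponent -/

section Sensing

variable {n p : ℕ} {al au : ℝ} {B : Matrix (Fin n) (Fin p) ℝ}

theorem sensingMatrix_ge (ha : al < au) (hn : 0 < n)
    (hB : ∀ i j, B i j ∈ Set.Icc (al / √(n : ℝ)) (au / √(n : ℝ))) (i : Fin n) (j : Fin p) :
    1 / (2 * (n : ℝ)) ≤ sensingMatrix al au B i j := by
  have hn' : (0 : ℝ) < n := by exact_mod_cast hn
  have hq : 0 < √(n : ℝ) := Real.sqrt_pos.2 hn'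
  have hd : 0 < au - al := sub_pos.2 ha
  have h1 : (au - al) / √(n : ℝ) ≤ B i j + (au - 2 * al) / √(n : ℝ) := by
    have := (hB i j).1
    have e : (au - al) / √(n : ℝ) = al / √(n : ℝ) + (au - 2 * al) / √(n : ℝ) := by ring
    linarith
  simp only [sensingMatrix, Matrix.of_apply]
  rw [le_div_iff₀ (by positivity)]
  refine le_trans (le_of_eq ?_) h1
  have hs := Real.mul_self_sqrt hn'.le
  field_simp
  nlinarith

theorem sensingMatrix_mulVec_ge (ha : al < au) (hn : 0 < n)
    (hB : ∀ i j, B i j ∈ Set.Icc (al / √(n : ℝ)) (au / √(n : ℝ))) {f : Fin p → ℝ}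
    (hf : ∀ j, 0 ≤ f j) (hf1 : ∑ j, f j = 1) (i : Fin n) :
    1 / (2 * (n : ℝ)) ≤ (sensingMatrix al au B *ᵥ f) i := by
  simp only [Matrix.mulVec, dotProduct]
  calc 1 / (2 * (n : ℝ)) = ∑ j, 1 / (2 * (n : ℝ)) * f j := by rw [← Finset.mul_sum, hf1, mul_one]
    _ ≤ _ := Finset.sum_le_sum fun j _ =>
        mul_le_mul_of_nonneg_right (sensingMatrix_ge ha hn hB i j) (hf j)

/-- The constant shift annihilates mean-zero vectors, so signal differences see only `B`. -/
theorem sensingMatrix_mulVec_of_sum_eq_zero {h : Fin p → ℝ} (hh : ∑ j, h j = 0) (i : Fin n) :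
    (sensingMatrix al au B *ᵥ h) i = (B *ᵥ h) i / (2 * (au - al) * √(n : ℝ)) := by
  simp only [Matrix.mulVec, dotProduct, sensingMatrix, Matrix.of_apply]
  have : ∀ j, (B i j + (au - 2 * al) / √(n : ℝ)) / (2 * (au - al) * √(n : ℝ)) * h j =
      B i j * h j / (2 * (au - al) * √(n : ℝ)) +
        (au - 2 * al) / √(n : ℝ) / (2 * (au - al) * √(n : ℝ)) * h j := fun j => by ring
  simp only [this, Finset.sum_add_distrib, ← Finset.mul_sum, hh, mul_zero, add_zero,
    ← Finset.sum_div]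

/-- The chi-square exponent between the Poisson models with signals `f` and `g`. -/
theorem sum_sq_div_le (ha : al < au) (hn : 0 < n)
    (hB : ∀ i j, B i j ∈ Set.Icc (al / √(n : ℝ)) (au / √(n : ℝ))) {f g : Fin p → ℝ}
    (hf : ∀ j, 0 ≤ f j) (hf1 : ∑ j, f j = 1) (hg : ∀ j, 0 ≤ g j) (hg1 : ∑ j, g j = 1)
    {T : ℝ} (hT : 0 < T) :
    ∑ i, (((T * (sensingMatrix al au B *ᵥ f) i).toNNReal : ℝ) -
        (T * (sensingMatrix al au B *ᵥ g) i).toNNReal) ^ 2 /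
          (T * (sensingMatrix al au B *ᵥ g) i).toNNReal ≤
      T / (2 * (au - al) ^ 2) * l2norm (B *ᵥ (f - g)) ^ 2 := by
  have hn' : (0 : ℝ) < n := by exact_mod_cast hn
  have hd : 0 < au - al := sub_pos.2 ha
  rw [l2norm_sq, Finset.mul_sum]
  refine Finset.sum_le_sum fun i _ => ?_
  have h0 : 0 < 1 / (2 * (n : ℝ)) := by positivity
  have hfi := sensingMatrix_mulVec_ge ha hn hB hf hf1 i
  have hgi := sensingMatrix_mulVec_ge ha hn hB hg hg1 i
  have hfg := sensingMatrix_mulVec_of_sum_eq_zero (al := al) (au := au) (B := B) (h := f - g)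
    (by simp [hf1, hg1]) i
  have hsub : (sensingMatrix al au B *ᵥ (f - g)) i =
    (sensingMatrix al au B *ᵥ f) i - (sensingMatrix al au B *ᵥ g) i := by
    rw [Matrix.mulVec_sub, Pi.sub_apply]
  rw [hsub] at hfg
  rw [Real.coe_toNNReal _ (mul_nonneg hT.le (h0.le.trans hfi)),
    Real.coe_toNNReal _ (mul_nonneg hT.le (h0.le.trans hgi)), ← mul_sub, hfg]
  have hs := Real.sq_sqrt hn'.le
  calc _ ≤ (T * ((B *ᵥ (f - g)) i / (2 * (au - al) * √(n : ℝ)))) ^ 2 / (T * (1 / (2 * n))) := by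
        gcongr
    _ = _ := by
        rw [mul_pow, div_pow, mul_pow, mul_pow, hs]
        field_simp

end Sensing

/-! ### Perturbations of the uniform signal -/

/-- There are `k` disjoint blocks of size `⌊(p - 1) / k⌋` among the last `p - 1` coordinates. -/
theorem nonempty_blocks_embedding (p k : ℕ) [NeZero p] :
    Nonempty (Fin k × Fin ((p - 1) / k) ↪ Tail p) := by
  refine Function.Embedding.nonempty_of_card_le ?_
  have : Fintype.card (Tail p) = p - 1 := by
    rw [Fintype.card_subtype_compl]; simp
  rw [this, Fintype.card_prod, Fintype.card_fin, Fintype.card_fin]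
  exact Nat.mul_div_le _ _

/-- The isometry keeps `D̄ v` nonzero. This excludes the default value of division by zero in the
rate and gives a positive amplitude. -/
theorem sparseLoc_dropFirst_pos {p k : ℕ} [NeZero p] {D : Matrix (Fin p) (Fin p) ℝ}
    (hD : IsBasis D) (hk : 1 ≤ k) (hkp : k ≤ p - 1) : 0 < sparseLoc k (dropFirst D) := by
  obtain ⟨e⟩ := nonempty_blocks_embedding p k
  have : NeZero ((p - 1) / k) := ⟨(Nat.div_pos hkp hk).ne'⟩
  refine (norm_pos_iff.2 fun h => ?_).trans_le (norm_mulVec_le_sparseLoc (dropFirst D)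
    (fun j => Or.inr (codeVec_eq_zero_or_one e 0 j)) (hammingNorm_codeVec e 0))
  have h1 := hD.l2norm_dropFirst_mulVec_sq (codeVec e 0)
  rw [h] at h1
  simp only [l2norm_sq, codeVec_sq, sum_codeVec] at h1
  have hk0 : (0 : ℝ) < k := by exact_mod_cast hk
  simp only [Pi.zero_apply, zero_pow two_ne_zero, Finset.sum_const_zero] at h1
  linarith

/-- The uniform signal perturbed along the columns of `D̄` marked by `v`. -/
noncomputable def perturbed {p : ℕ} [NeZero p] (D : Matrix (Fin p) (Fin p) ℝ) (η : ℝ) (v : Tail p → ℝ) :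
    Fin p → ℝ := (fun _ => 1 / (p : ℝ)) + η • (dropFirst D *ᵥ v)

section Perturbed

variable {p : ℕ} [NeZero p] {D : Matrix (Fin p) (Fin p) ℝ} {η : ℝ} {v : Tail p → ℝ}

theorem sum_perturbed (hD : IsBasis D) : ∑ i, perturbed D η v i = 1 := by
  have hp : (p : ℝ) ≠ 0 := by exact_mod_cast NeZero.ne p
  simp [perturbed, Finset.sum_add_distrib, ← Finset.mul_sum, hD.sum_dropFirst_mulVec, hp]

/-- No coordinate of the perturbation exceeds the uniform level `1/p` in absolute value. -/
theorem perturbed_nonneg {k : ℕ} (hη : 0 ≤ η) (hv : ∀ j, v j = -1 ∨ v j = 0 ∨ v j = 1)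
    (hk : hammingNorm v = k) (h : η * sparseLoc k (dropFirst D) ≤ 1 / p) (i : Fin p) :
    0 ≤ perturbed D η v i := by
  have h1 := (norm_le_pi_norm (dropFirst D *ᵥ v) i).trans (norm_mulVec_le_sparseLoc _ hv hk)
  rw [Real.norm_eq_abs] at h1
  have h2 := mul_le_mul_of_nonneg_left ((neg_le_abs _).trans h1) hη
  simp only [perturbed, Pi.add_apply, Pi.smul_apply, smul_eq_mul]
  linarith

theorem transpose_mulVec_perturbed (hD : IsBasis D) :
    (dropFirst D)ᵀ *ᵥ perturbed D η v = η • v := by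
  rw [perturbed, Matrix.mulVec_add, Matrix.mulVec_smul, Matrix.mulVec_mulVec,
    hD.transpose_mul_dropFirst, Matrix.one_mulVec]
  convert zero_add _
  ext j
  simp [Matrix.mulVec, dotProduct, ← Finset.sum_mul, hD.sum_dropFirst]

theorem perturbed_sub (v' : Tail p → ℝ) :
    perturbed D η v - perturbed D η v' = η • (dropFirst D *ᵥ (v - v')) := by
  simp [perturbed, Matrix.mulVec_sub, smul_sub]

theorem l2norm_smul_sq {ι : Type*} [Fintype ι] (c : ℝ) (x : ι → ℝ) :
    l2norm (c • x) ^ 2 = c ^ 2 * l2norm x ^ 2 := by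
  simp [l2norm_sq, mul_pow, Finset.mul_sum]

end Perturbed

/-! ### Minimax bound at a fixed sparsity -/

/-- Minimax lower bound from the perturbations of the uniform signal with `k` active columns and
amplitude `η`. -/
theorem half_lt_minimaxProb {n p K k : ℕ} [NeZero p] {al au δ q R T η r : ℝ}
    {D : Matrix (Fin p) (Fin p) ℝ} {B : Matrix (Fin n) (Fin p) ℝ}
    (ha : al < au) (hδ1 : δ < 1) (hn : 0 < n) (hq : 0 < q) (hT : 0 < T)
    (hp : 260 ≤ p) (hk : 1 ≤ k) (hkK : k ≤ 2 * K) (hkp : 33 * (k : ℝ) / 2 + 1 ≤ p)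
    (hD : IsBasis D) (hB : ∀ i j, B i j ∈ Set.Icc (al / √(n : ℝ)) (au / √(n : ℝ)))
    (hrip : UpperRIP (B * D) (2 * K) δ) (hη : 0 < η)
    (hηloc : η * sparseLoc k (dropFirst D) ≤ 1 / p) (hηR : k * η ^ q ≤ R)
    (hηT : T / (au - al) ^ 2 * (η ^ 2 * k) ≤ k * Real.log ((p : ℝ) / k) / 36)
    (hr : r ≤ η ^ 2 * k / 4) :
    1 / 2 < minimaxProb T (sensingMatrix al au B) (signalClass q R D) r := by
  obtain ⟨e⟩ := nonempty_blocks_embedding p k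
  have hs : 0 < (p - 1) / k := Nat.div_pos (by
    have : 33 * (k : ℝ) + 2 ≤ 2 * p := by linarith
    have : 33 * k + 2 ≤ 2 * p := by exact_mod_cast this
    omega) hk
  have : NeZero ((p - 1) / k) := ⟨hs.ne'⟩
  have hd : 0 < au - al := sub_pos.2 ha
  set s := (p - 1) / k with hs_def
  let A := sensingMatrix al au B
  let f : (Fin k → Fin s) → Fin p → ℝ := fun w => perturbed D η (codeVec e w)
  let f₀ : Fin p → ℝ := perturbed D η 0
  have hv : ∀ w j, codeVec e w j = -1 ∨ codeVec e w j = 0 ∨ codeVec e w j = 1 := fun w j =>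
    Or.inr (codeVec_eq_zero_or_one e w j)
  have hf0 : ∀ w i, 0 ≤ f w i := fun w =>
    perturbed_nonneg hη.le (hv w) (hammingNorm_codeVec e w) hηloc
  have hf1 : ∀ w, ∑ i, f w i = 1 := fun w => sum_perturbed hD
  have hg0 : ∀ i, 0 ≤ f₀ i := fun i => by simp [f₀, perturbed]
  have hg1 : ∑ i, f₀ i = 1 := sum_perturbed hD
  have hmem : ∀ w, f w ∈ signalClass q R D := fun w => by
    refine ⟨hf0 w, ?_, ?_⟩
    · simpa only [abs_of_nonneg (hf0 w _)] using hf1 w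
    · rw [transpose_mulVec_perturbed hD]
      simpa only [Pi.smul_apply, smul_eq_mul, sum_abs_mul_codeVec_rpow e w hη.le hq] using hηR
  have hchi : ∀ w, Real.exp (∑ i, (((T * (A *ᵥ f w) i).toNNReal : ℝ) -
        (T * (A *ᵥ f₀) i).toNNReal) ^ 2 / (T * (A *ᵥ f₀) i).toNNReal) ≤
      Real.exp (k * Real.log ((p : ℝ) / k) / 36) := fun w => by
    refine Real.exp_le_exp.2 (le_trans ?_ hηT)
    refine (sum_sq_div_le ha hn hB (hf0 w) (hf1 w) hg0 hg1 hT).trans ?_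
    have h1 := hrip.l2norm_mulVec_dropFirst_sq_le (codeVec e w)
      ((hammingNorm_codeVec e w).le.trans hkK)
    simp only [codeVec_sq, sum_codeVec] at h1
    have h2 : l2norm (B *ᵥ (f w - f₀)) ^ 2 ≤ η ^ 2 * (2 * k) := by
      rw [perturbed_sub, sub_zero, Matrix.mulVec_smul, l2norm_smul_sq]
      refine mul_le_mul_of_nonneg_left (h1.trans ?_) (sq_nonneg _)
      exact mul_le_mul_of_nonneg_right (by linarith) (by positivity)
    calc _ ≤ T / (2 * (au - al) ^ 2) * (η ^ 2 * (2 * k)) := by gcongr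
      _ = _ := by field_simp
  -- An infimum preserves only weak inequalities, so every estimator is held to `11/20 = 1 - 9/20`.
  refine lt_of_lt_of_le (b := ENNReal.ofReal (11 / 20)) ?_ (le_iInf₂ fun fhat _ => ?_)
  · rw [ENNReal.lt_ofReal_iff_toReal_lt (by simp)]
    norm_num
  let E : (Fin k → Fin s) → Set (Fin n → ℕ) := fun w => {y | l2norm (fhat y - f w) ^ 2 < r}
  have hdist : ∀ y w w', y ∈ E w → y ∈ E w' → 2 * hammingDist w w' < k := fun y w w' h h' => by
    simp only [E, Set.mem_ofPred_eq] at h h'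
    have h1 := l2norm_sub_sq_le (fhat y) (f w) (f w')
    rw [perturbed_sub, l2norm_smul_sq, hD.l2norm_dropFirst_mulVec_sq] at h1
    simp only [Pi.sub_apply, sum_codeVec_sub_sq] at h1
    -- The two errors bound the left side by less than `4 * r`, and `4 * r ≤ η ^ 2 * k`.
    have h2 : η ^ 2 * (2 * hammingDist w w' : ℝ) < η ^ 2 * k := by linarith
    exact_mod_cast lt_of_mul_lt_mul_left h2 (sq_nonneg η)
  have hN : ∀ y, ∑ w, (E w).indicator (1 : (Fin n → ℕ) → ℝ) y ≤ (2 * √(s : ℝ)) ^ k := fun y => by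
    classical
    by_cases hy : ∃ w₀, y ∈ E w₀
    · obtain ⟨w₀, hw₀⟩ := hy
      refine le_trans ?_ (card_hammingDist_lt_le k s w₀)
      rw [Finset.card_filter, Nat.cast_sum]
      refine Finset.sum_le_sum fun w _ => ?_
      by_cases hw : y ∈ E w
      · simp [hw, hdist y w w₀ hw hw₀]
      · rw [Set.indicator_of_notMem hw]; positivity
    · push Not at hy
      rw [Finset.sum_eq_zero fun w _ => by simp [hy w]]
      positivity
  have hcard := five_mul_exp_mul_le hk hp hkp le_rfl
  rw [← hs_def] at hcard
  have hgi : ∀ i, 0 < (T * (A *ᵥ f₀) i).toNNReal := fun i => by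
    have h0 : 0 < 1 / (2 * (n : ℝ)) := by positivity
    exact Real.toNNReal_pos.2 (mul_pos hT (h0.trans_le
      (sensingMatrix_mulVec_ge ha hn hB hg0 hg1 i)))
  obtain ⟨w, hw⟩ := exists_pi_poissonMeasure_real_le (fun w i => (T * (A *ᵥ f w) i).toNNReal)
    (fun i => (T * (A *ᵥ f₀) i).toNNReal) hgi hchi (by simpa using hcard) E hN
  refine le_trans ?_ (le_iSup₂ (f := fun f _ => poissonLaw T A f {y | r ≤ l2norm (fhat y - f) ^ 2})
    (f w) (hmem w))
  have hc : {y | r ≤ l2norm (fhat y - f w) ^ 2} = (E w)ᶜ := by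
    ext y; simp [E]
  rw [hc]
  unfold poissonLaw
  rw [← ofReal_measureReal]
  refine ENNReal.ofReal_le_ofReal ?_
  rw [probReal_compl_eq_one_sub (E w).to_countable.measurableSet]
  linarith

/-! ### Scaling of the rate and the `ℓ_q` constraint -/

/-- `k log(p/k) / T` against the rate `R (log p / T)^{1 - q/2}`, from above. -/
theorem mul_log_div_le {p K : ℕ} {q R T c₀ : ℝ} (hp : 1 < p) (hK : 1 ≤ K) (hT : 0 < T)
    (h : (K : ℝ) ≤ c₀ * (R * (Real.log p / T) ^ (-(q / 2)))) :
    (K : ℝ) * Real.log ((p : ℝ) / K) / T ≤ c₀ * (R * (Real.log p / T) ^ (1 - q / 2)) := by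
  have hp' : (1 : ℝ) < p := by exact_mod_cast hp
  have hK' : (1 : ℝ) ≤ K := by exact_mod_cast hK
  have hL : 0 < Real.log p / T := div_pos (Real.log_pos hp') hT
  have hlog : Real.log ((p : ℝ) / K) ≤ Real.log p :=
    Real.log_le_log (by positivity) (div_le_self (by positivity) hK')
  rw [sub_eq_add_neg, Real.rpow_add hL, Real.rpow_one]
  calc (K : ℝ) * Real.log ((p : ℝ) / K) / T ≤ K * Real.log p / T := by gcongr
    _ = K * (Real.log p / T) := by ring
    _ ≤ _ := mul_le_mul_of_nonneg_right h hL.le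
    _ = _ := by ring

/-- `k log(p/k) / T` against the rate `R (log p / T)^{1 - q/2}`, from below. -/
theorem le_mul_log_div {p K : ℕ} {q R T c₁ ε : ℝ} (hp : 1 < p) (hK : 1 ≤ K) (hT : 0 < T)
    (hε : 0 < ε) (h : c₁ * (R * (Real.log p / T) ^ (-(q / 2))) ≤ (K : ℝ))
    (hKp : (K : ℝ) ≤ (p : ℝ) ^ (1 - ε)) :
    ε * c₁ * (R * (Real.log p / T) ^ (1 - q / 2)) ≤ (K : ℝ) * Real.log ((p : ℝ) / K) / T := by
  have hp' : (1 : ℝ) < p := by exact_mod_cast hp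
  have hK' : (0 : ℝ) < K := by exact_mod_cast hK
  have hL : 0 < Real.log p / T := div_pos (Real.log_pos hp') hT
  have hlog : ε * Real.log p ≤ Real.log ((p : ℝ) / K) := by
    have h1 := Real.log_le_log hK' hKp
    rw [Real.log_rpow (by positivity)] at h1
    rw [Real.log_div (by positivity) hK'.ne']
    linarith
  rw [sub_eq_add_neg, Real.rpow_add hL, Real.rpow_one]
  calc _ = c₁ * (R * (Real.log p / T) ^ (-(q / 2))) * (ε * (Real.log p / T)) := by ring
    _ ≤ K * (ε * (Real.log p / T)) := mul_le_mul_of_nonneg_right h (by positivity)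
    _ = K * (ε * Real.log p) / T := by ring
    _ ≤ _ := by gcongr

/-- The amplitude allowed by the `ℓ_q` constraint. -/
theorem mul_rpow_le_of_sq_le {k K q R L c₀ η : ℝ} (hk : k ≤ K) (hq : 0 < q) (hL : 0 < L)
    (hR : 0 < R) (hc₀ : 0 < c₀) (hη : 0 ≤ η) (hηL : η ^ 2 ≤ c₀ ^ (-(2 / q)) * L)
    (h : K ≤ c₀ * (R * L ^ (-(q / 2)))) : k * η ^ q ≤ R := by
  have h1 : η ^ q ≤ c₀⁻¹ * L ^ (q / 2) := by
    have h2 := Real.rpow_le_rpow (sq_nonneg η) hηL (show 0 ≤ q / 2 by positivity)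
    rw [Real.mul_rpow (by positivity) hL.le, ← Real.rpow_mul hc₀.le, ← Real.rpow_natCast,
      ← Real.rpow_mul hη] at h2
    have e1 : ((2 : ℕ) : ℝ) * (q / 2) = q := by push_cast; ring
    have e2 : -(2 / q) * (q / 2) = -1 := by field_simp
    rwa [e1, e2, Real.rpow_neg_one] at h2
  have hηq : 0 ≤ η ^ q := Real.rpow_nonneg hη q
  have hLq : 0 < L ^ (q / 2) := Real.rpow_pos_of_pos hL _
  calc k * η ^ q ≤ c₀ * (R * L ^ (-(q / 2))) * η ^ q :=
        mul_le_mul_of_nonneg_right (hk.trans h) hηq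
    _ ≤ c₀ * (R * L ^ (-(q / 2))) * (c₀⁻¹ * L ^ (q / 2)) := by gcongr
    _ = R := by
        rw [Real.rpow_neg hL.le]
        field_simp

end PoissonInverse

/-! ### Choice of amplitude and conclusion -/

theorem theorem2p1 (al au δ : ℝ) (ha : al < au) (hδ0 : 0 < δ) (hδ1 : δ < 1) :
    ∃ C : ℝ, 0 < C ∧
      ∀ (n p : ℕ) [NeZero p] (K : ℕ) (hK : 1 ≤ K) (q R T c₀ : ℝ)
        (D : Matrix (Fin p) (Fin p) ℝ) (B A : Matrix (Fin n) (Fin p) ℝ),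
        0 < n → 0 < q → q ≤ 1 → 0 < R → 0 < T → 0 < c₀ →
        260 ≤ p → 33 * (K : ℝ) / 2 + 1 ≤ (p : ℝ) →
        PoissonInverse.IsBasis D →
        (∀ i j, B i j ∈ Set.Icc (al / √(n : ℝ)) (au / √(n : ℝ))) →
        A = PoissonInverse.sensingMatrix al au B →
        PoissonInverse.UpperRIP (B * D) (2 * K) δ →
        (K : ℝ) ≤ c₀ * (R * (Real.log p / T) ^ (-(q / 2))) →
        -- the minimax lower bound, with probability greater than one half
        1 / 2 < PoissonInverse.minimaxProb T A (PoissonInverse.signalClass q R D)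
            (C * min 1 (c₀ ^ (-(2 / q))) * PoissonInverse.lowerRate T D K hK) ∧
        -- the scaling of the second term at `k = K`
        (K : ℝ) * Real.log ((p : ℝ) / K) / T ≤ c₀ * (R * (Real.log p / T) ^ (1 - q / 2)) ∧
        ∀ c₁ ε : ℝ, 0 < c₁ → 0 < ε →
          c₁ * (R * (Real.log p / T) ^ (-(q / 2))) ≤ (K : ℝ) → (K : ℝ) ≤ (p : ℝ) ^ (1 - ε) →
          ε * c₁ * (R * (Real.log p / T) ^ (1 - q / 2)) ≤
            (K : ℝ) * Real.log ((p : ℝ) / K) / T := by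
  have hd : 0 < au - al := sub_pos.2 ha
  -- The bound by 1 serves nonnegativity and the `ℓ_q` constraint; the other cancels `(au - al) ^ 2`
  -- in the chi-square exponent and supplies its `1/36`.
  set κ : ℝ := min 1 ((au - al) ^ 2 / 36) with hκ_def
  have hκ : 0 < κ := by positivity
  refine ⟨κ / 4, by positivity, ?_⟩
  intro n p _ K hK q R T c₀ D B A hn hq _ hR hT hc₀ hp hKp hD hB hA hrip hKR
  refine ⟨?_, PoissonInverse.mul_log_div_le (by omega) hK hT hKR, fun c₁ ε _ hε h1 h2 =>
    PoissonInverse.le_mul_log_div (by omega) hK hT hε h1 h2⟩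
  subst hA
  -- The hypotheses are built at the sparsity attaining the maximum.
  obtain ⟨k, hkmem, hk_eq⟩ := Finset.exists_mem_eq_sup' (Finset.nonempty_Icc.mpr hK) fun k : ℕ =>
    min ((k : ℝ) / ((p : ℝ) ^ 2 * PoissonInverse.sparseLoc k (PoissonInverse.dropFirst D) ^ 2))
      ((k : ℝ) * Real.log ((p : ℝ) / k) / T)
  obtain ⟨hk, hkK⟩ := Finset.mem_Icc.1 hkmem
  have hkK' : (k : ℝ) ≤ K := by exact_mod_cast hkK
  have hk' : (1 : ℝ) ≤ k := by exact_mod_cast hk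
  have hp' : (260 : ℝ) ≤ p := by exact_mod_cast hp
  have hkp : 33 * (k : ℝ) / 2 + 1 ≤ p := by linarith
  have hkp1 : (k : ℝ) + 1 ≤ p := by linarith
  have hkp1' : k + 1 ≤ p := by exact_mod_cast hkp1
  have hlam := PoissonInverse.sparseLoc_dropFirst_pos hD hk (by omega : k ≤ p - 1)
  set lam := PoissonInverse.sparseLoc k (PoissonInverse.dropFirst D) with hlam_def
  have hlog : 0 < Real.log ((p : ℝ) / k) :=
    Real.log_pos ((one_lt_div (by positivity)).2 (by linarith))
  set μ : ℝ := min 1 (c₀ ^ (-(2 / q))) with hμ_def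
  have hμ : 0 < μ := by positivity
  set m : ℝ := min (1 / ((p : ℝ) ^ 2 * lam ^ 2)) (Real.log ((p : ℝ) / k) / T) with hm_def
  have hm : 0 < m := by positivity
  -- The factor `μ` pays for the `ℓ_q` radius, the two terms of `m` for nonnegativity and
  -- indistinguishability.
  have hη2 : √(κ * μ * m) ^ 2 = κ * μ * m := Real.sq_sqrt (by positivity)
  have hη : 0 < √(κ * μ * m) := by positivity
  set η := √(κ * μ * m)
  have hκ1 : κ ≤ 1 := min_le_left _ _
  have hμ1 : μ ≤ 1 := min_le_left _ _
  have hκμ : κ * μ ≤ 1 := mul_le_one₀ hκ1 hμ.le hμ1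
  have hmlog : m ≤ Real.log ((p : ℝ) / k) / T := min_le_right _ _
  have hrate : PoissonInverse.lowerRate T D K hK = k * m := by
    unfold PoissonInverse.lowerRate
    rw [hk_eq, hm_def, mul_min_of_nonneg _ _ (by positivity)]
    congr 1 <;> ring
  refine PoissonInverse.half_lt_minimaxProb ha hδ1 hn hq hT hp hk (by omega) hkp hD hB hrip hη
    ?_ ?_ ?_ ?_
  · rw [← hlam_def]
    refine le_of_sq_le_sq ?_ (by positivity)
    calc (η * lam) ^ 2 = κ * μ * m * lam ^ 2 := by rw [mul_pow, hη2]
      _ ≤ 1 * (1 / ((p : ℝ) ^ 2 * lam ^ 2)) * lam ^ 2 := by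
          gcongr
          exact min_le_left _ _
      _ = (1 / (p : ℝ)) ^ 2 := by field_simp
  · refine PoissonInverse.mul_rpow_le_of_sq_le hkK' hq
      (div_pos (Real.log_pos (by linarith)) hT) hR hc₀ hη.le ?_ hKR
    rw [hη2]
    have h1 : m ≤ Real.log p / T := hmlog.trans (by
      gcongr
      exact div_le_self (by positivity) hk')
    calc κ * μ * m ≤ 1 * c₀ ^ (-(2 / q)) * (Real.log p / T) := by
          gcongr
          exact min_le_right _ _
      _ = _ := by rw [one_mul]
  · rw [hη2]
    calc T / (au - al) ^ 2 * (κ * μ * m * k)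
        ≤ T / (au - al) ^ 2 * ((au - al) ^ 2 / 36 * 1 * (Real.log ((p : ℝ) / k) / T) * k) := by
          gcongr
          exact min_le_right _ _
      _ = _ := by field_simp
  · rw [hrate, hη2]
    exact le_of_eq (by ring)
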